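/- All Hilbert spaces are finite-dimensional and nonzero, each with a fixed orthonormal basis, and $d_S$ denotes the dimension of $\mathcal H_S$. A matrix $M_{IO}\ge 0$ with $\operatorname{tr}_O M=\mathbb 1_I$ is the Choi matrix of a CPTP map from $I$ to $O$; an instrument element is the Choi matrix of a CP map which some other CP map completes to a CPTP map. The link product $F_{XY}\star L_{YZ}=\operatorname{tr}_Y[(F_{XY}\otimes\mathbb 1_Z)(\mathbb 1_X\otimes L_{YZ}^{\mathrm T_Y})]$ composes Choi matrices. **Processes.** A two-party process matrix is an operator $W\ge 0$ on $X_I\otimes X_O\otimes Y_I\otimes Y_O$ such that $W\star M_X\star M_Y=\operatorname{tr}[W^{\mathrm T}(M_X\otimes M_Y)]=1$ for all CPTP maps $M_X$ from $X_I$ to $X_O$ and $M_Y$ from $Y_I$ to $Y_O$. It has causal order $X\prec Y$ if $Y$ cannot signal to $X$, i.e. if $W\star M_X\star M_Y=W\star M_X\star M_Y'$ for every instrument element $M_X$ and all CPTP maps $M_Y,M_Y'$. If $d_{X_O}=d_{Y_I}$, the fully signalling process is $$W^{X\to Y}=\frac{\mathbb 1_{X_I}}{d_{X_I}}\otimes\Phi^+_{X_OY_I}\otimes\mathbb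 1_{Y_O},\qquad \Phi^+=\sum_{i,j}|ii\rangle\langle jj|.$$ **Adapters.** An adapter $\Upsilon$ is an operator on the tensor product of the spaces $Z_I,Z_I',Z_O',Z_O$ for $Z\in\{X,Y\}$, and it acts on process matrices by $W\mapsto\Upsilon\star W$. Write ${}_SM=\frac{\mathbb 1_S}{d_S}\otimes\operatorname{tr}_SM$. The adapter $\Upsilon$ is free (non-signalling) if $\Upsilon\ge 0$, $\Upsilon=(L_X\otimes L_Y)[\Upsilon]$ and $\operatorname{tr}\Upsilon=d_{X_I}d_{X_O'}d_{Y_I}d_{Y_O'}$, where $$L_Z[\Upsilon]=\Upsilon-{}_{Z_O}\Upsilon+{}_{Z_OZ_O'}\Upsilon-{}_{Z_I'Z_OZ_O'}\Upsilon+{}_{Z_IZ_I'Z_OZ_O'}\Upsilon .$$ It is local if $\Upsilon=C_X\otimes C_Y$, where each $C_Z=\Lambda\star\Gamma$ is the link product, over a finite-dimensional memory $M$, of a CPTP map $\Lambda$ from $Z_I$ to $Z_I'\otimes M$ and a CPTP map $\Gamma$ from $Z_O'\otimes M$ to $Z_O$. **Proposition.** Let $W^{X\to Y}$ be the fully signalling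 process on spaces $X_I,X_O,Y_I,Y_O$ with $d_{X_O}=d_{Y_I}$, and let $W'_{X'Y'}$ be a two-party process matrix with causal order $X'\prec Y'$ on spaces with $d_{X_I'}\le d_{X_I}$, $d_{X_O'}\le d_{X_O}$, $d_{Y_I'}\le d_{Y_I}$ and $d_{Y_O'}\le d_{Y_O}$. Then there is a free (non-signalling) adapter $\Upsilon$, which is moreover local, such that $W'_{X'Y'}=\Upsilon\star W^{X\to Y}$. -/

import Mathlib

open scoped Kronecker ComplexOrder

/- Finite-dimensional Hilbert spaces are given with an orthonormal basis indexed by a finite type,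
operators are complex matrices over that type, and a tensor product is indexed by the product
type. -/

/-- The partial trace over the second tensor factor. -/
def partialTraceSnd {I O : Type*} [Fintype O] (M : Matrix (I × O) (I × O) ℂ) : Matrix I I ℂ :=
  fun i j => ∑ o, M (i, o) (j, o)

/-- `M` is the Choi matrix of a CPTP map from `I` to `O`. -/
def IsChannel {I O : Type*} [Fintype O] [DecidableEq I]
    (M : Matrix (I × O) (I × O) ℂ) : Prop :=
  M.PosSemidef ∧ partialTraceSnd M = 1

/-- `M` is the Choi matrix of an element of a quantum instrument from `I` to `O`, i.e. of a CP map
that some other CP map completes to a CPTP map. -/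
def IsInstrumentElement {I O : Type*} [Fintype O] [DecidableEq I]
    (M : Matrix (I × O) (I × O) ℂ) : Prop :=
  M.PosSemidef ∧ ∃ N : Matrix (I × O) (I × O) ℂ, N.PosSemidef ∧ IsChannel (M + N)

section Processes

variable {XI XO YI YO : Type*} [Fintype XI] [Fintype XO] [Fintype YI] [Fintype YO]

/-- The number `W ⋆ M_X ⋆ M_Y = tr[Wᵀ (M_X ⊗ M_Y)]`: the probability that the parties `X` and `Y`,
sharing `W`, obtain the outcomes with Choi matrices `M_X` and `M_Y`. -/
def outcomeProb (W : Matrix ((XI × XO) × (YI × YO)) ((XI × XO) × (YI × YO)) ℂ)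
    (MX : Matrix (XI × XO) (XI × XO) ℂ) (MY : Matrix (YI × YO) (YI × YO) ℂ) : ℂ :=
  (W.transpose * (MX ⊗ₖ MY)).trace

/-- `W` is a (proper) two-party process matrix. -/
def IsProcess [DecidableEq XI] [DecidableEq YI]
    (W : Matrix ((XI × XO) × (YI × YO)) ((XI × XO) × (YI × YO)) ℂ) : Prop :=
  W.PosSemidef ∧ ∀ MX MY, IsChannel MX → IsChannel MY → outcomeProb W MX MY = 1

/-- `W` is a process matrix with causal order `X ≺ Y`: the choice of the operation of the party `Y`
does not influence the statistics of the party `X`. -/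
def IsCausallyOrdered [DecidableEq XI] [DecidableEq YI]
    (W : Matrix ((XI × XO) × (YI × YO)) ((XI × XO) × (YI × YO)) ℂ) : Prop :=
  IsProcess W ∧ ∀ MX MY MY', IsInstrumentElement MX → IsChannel MY → IsChannel MY' →
    outcomeProb W MX MY = outcomeProb W MX MY'

end Processes

/-- The unnormalised maximally entangled operator `Φ⁺ = ∑ i j, |ii⟩⟨jj|`, which is the Choi matrix
of the identity channel. -/
def phiPlus (Q : Type*) [DecidableEq Q] : Matrix (Q × Q) (Q × Q) ℂ :=
  fun u v => if u.1 = u.2 ∧ v.1 = v.2 then 1 else 0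

/-- The fully signalling process `𝟙_{X_I} / d_{X_I} ⊗ Φ⁺_{X_O Y_I} ⊗ 𝟙_{Y_O}`; the spaces `X_O` and
`Y_I` are both copies of `Q`. -/
noncomputable def fullySignalling (XI Q YO : Type*) [Fintype XI] [DecidableEq XI] [DecidableEq Q]
    [DecidableEq YO] : Matrix ((XI × Q) × (Q × YO)) ((XI × Q) × (Q × YO)) ℂ :=
  (((Fintype.card XI : ℂ)⁻¹ • (1 : Matrix XI XI ℂ)) ⊗ₖ phiPlus Q ⊗ₖ
      (1 : Matrix YO YO ℂ)).submatrix
    (fun u => ((u.1.1, (u.1.2, u.2.1)), u.2.2)) (fun u => ((u.1.1, (u.1.2, u.2.1)), u.2.2))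

section Adapter

/- The part of an adapter that lies in the laboratory of one party is indexed by
`I × I' × O' × O`: the adapter receives `I`, hands out `I'`, receives `O'` and returns `O`, so that
it turns a process on `I, O` into a process on `I', O'`. -/

/-- Trace and replace, `_T M = 𝟙_T / d_T ⊗ tr_T M`, where `e` exhibits `T` as a tensor factor of
the space `K`. -/
noncomputable def traceReplace {K T R : Type*} [Fintype T] [DecidableEq T] (e : K ≃ T × R)
    (M : Matrix K K ℂ) : Matrix K K ℂ :=
  fun k l => if (e k).1 = (e l).1 then
    (Fintype.card T : ℂ)⁻¹ * ∑ t, M (e.symm (t, (e k).2)) (e.symm (t, (e l).2)) else 0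

/-- The factor `O` of `(I × I' × O' × O) × R`. -/
def splitO (I I' O' O R : Type*) : (I × I' × O' × O) × R ≃ O × ((I × I' × O') × R) where
  toFun u := (u.1.2.2.2, ((u.1.1, u.1.2.1, u.1.2.2.1), u.2))
  invFun v := ((v.2.1.1, v.2.1.2.1, v.2.1.2.2, v.1), v.2.2)
  left_inv _ := rfl
  right_inv _ := rfl

/-- The factor `O' × O` of `(I × I' × O' × O) × R`. -/
def splitOO (I I' O' O R : Type*) : (I × I' × O' × O) × R ≃ (O' × O) × ((I × I') × R) where
  toFun u := (u.1.2.2, ((u.1.1, u.1.2.1), u.2))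
  invFun v := ((v.2.1.1, v.2.1.2, v.1), v.2.2)
  left_inv _ := rfl
  right_inv _ := rfl

/-- The factor `I' × O' × O` of `(I × I' × O' × O) × R`. -/
def splitIOO (I I' O' O R : Type*) : (I × I' × O' × O) × R ≃ (I' × O' × O) × (I × R) where
  toFun u := (u.1.2, (u.1.1, u.2))
  invFun v := ((v.2.1, v.1), v.2.2)
  left_inv _ := rfl
  right_inv _ := rfl

/-- The map `L[M] = M - _O M + _{O O'} M - _{I' O O'} M + _{I I' O O'} M` that acts on the first
tensor factor `I × I' × O' × O`. -/
noncomputable def projFst {I I' O' O R : Type*} [Fintype I] [Fintype I'] [Fintype O'] [Fintype O]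
    [DecidableEq I] [DecidableEq I'] [DecidableEq O'] [DecidableEq O]
    (M : Matrix ((I × I' × O' × O) × R) ((I × I' × O' × O) × R) ℂ) :
    Matrix ((I × I' × O' × O) × R) ((I × I' × O' × O) × R) ℂ :=
  M - traceReplace (splitO I I' O' O R) M + traceReplace (splitOO I I' O' O R) M
    - traceReplace (splitIOO I I' O' O R) M + traceReplace (Equiv.refl _) M

/-- The same map acting on the second tensor factor. -/
noncomputable def projSnd {I I' O' O R : Type*} [Fintype I] [Fintype I'] [Fintype O'] [Fintype O]
    [DecidableEq I] [DecidableEq I'] [DecidableEq O'] [DecidableEq O]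
    (M : Matrix (R × (I × I' × O' × O)) (R × (I × I' × O' × O)) ℂ) :
    Matrix (R × (I × I' × O' × O)) (R × (I × I' × O' × O)) ℂ :=
  (projFst (M.submatrix Prod.swap Prod.swap)).submatrix Prod.swap Prod.swap

variable {XI XI' XO' XO YI YI' YO' YO : Type*}
  [Fintype XI] [Fintype XI'] [Fintype XO'] [Fintype XO]
  [Fintype YI] [Fintype YI'] [Fintype YO'] [Fintype YO]

/-- Non-signalling adapters, which are the free transformations: `Υ ≥ 0`,
`Υ = (L_X ⊗ L_Y)[Υ]` and `tr Υ = d_{X_I} d_{X_O'} d_{Y_I} d_{Y_O'}`. -/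
def IsNonSignallingAdapter
    [DecidableEq XI] [DecidableEq XI'] [DecidableEq XO'] [DecidableEq XO]
    [DecidableEq YI] [DecidableEq YI'] [DecidableEq YO'] [DecidableEq YO]
    (U : Matrix ((XI × XI' × XO' × XO) × (YI × YI' × YO' × YO))
      ((XI × XI' × XO' × XO) × (YI × YI' × YO' × YO)) ℂ) : Prop :=
  U.PosSemidef ∧ U = projFst (projSnd U) ∧
    U.trace = (Fintype.card XI * Fintype.card XO' * Fintype.card YI * Fintype.card YO' : ℂ)

/-- The local comb `Λ ⋆ Γ`: a pre-processing `Λ` from `I` to `I' ⊗ M` and a post-processing `Γ`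
from `O' ⊗ M` to `O`, linked by the memory `M`. -/
def linkMemory {I I' O' O M : Type*} [Fintype M]
    (L : Matrix (I × (I' × M)) (I × (I' × M)) ℂ) (G : Matrix ((O' × M) × O) ((O' × M) × O) ℂ) :
    Matrix (I × I' × O' × O) (I × I' × O' × O) ℂ :=
  fun u v => ∑ m, ∑ n, L (u.1, (u.2.1, m)) (v.1, (v.2.1, n)) *
    G ((u.2.2.1, m), u.2.2.2) ((v.2.2.1, n), v.2.2.2)

/-- `C` is a comb that a single party can implement in its own laboratory, by a CPTP pre-processing
and a CPTP post-processing connected by a finite-dimensional quantum memory. -/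
def IsLocalComb {I I' O' O : Type*} [Fintype I'] [Fintype O]
    [DecidableEq I] [DecidableEq O'] (C : Matrix (I × I' × O' × O) (I × I' × O' × O) ℂ) : Prop :=
  ∃ (d : ℕ) (L : Matrix (I × (I' × Fin d)) (I × (I' × Fin d)) ℂ)
    (G : Matrix ((O' × Fin d) × O) ((O' × Fin d) × O) ℂ),
    IsChannel L ∧ IsChannel G ∧ C = linkMemory L G

/-- `Υ` is a local adapter: the two parties apply independent local combs, without any shared
state. -/
def IsLocalAdapter [DecidableEq XI] [DecidableEq XO'] [DecidableEq YI] [DecidableEq YO']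
    (U : Matrix ((XI × XI' × XO' × XO) × (YI × YI' × YO' × YO))
      ((XI × XI' × XO' × XO) × (YI × YI' × YO' × YO)) ℂ) : Prop :=
  ∃ (CX : Matrix (XI × XI' × XO' × XO) (XI × XI' × XO' × XO) ℂ)
    (CY : Matrix (YI × YI' × YO' × YO) (YI × YI' × YO' × YO) ℂ),
    IsLocalComb CX ∧ IsLocalComb CY ∧ U = CX ⊗ₖ CY

/-- The link product `Υ ⋆ W = tr_{XY}[Υ (Wᵀ ⊗ 𝟙_{X'Y'})]`, i.e. the result of applying the adapter
`Υ` to the process matrix `W`. -/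
def applyAdapter
    (U : Matrix ((XI × XI' × XO' × XO) × (YI × YI' × YO' × YO))
      ((XI × XI' × XO' × XO) × (YI × YI' × YO' × YO)) ℂ)
    (W : Matrix ((XI × XO) × (YI × YO)) ((XI × XO) × (YI × YO)) ℂ) :
    Matrix ((XI' × XO') × (YI' × YO')) ((XI' × XO') × (YI' × YO')) ℂ :=
  fun p q => ∑ u, ∑ v,
    U ((u.1.1, p.1.1, p.1.2, u.1.2), (u.2.1, p.2.1, p.2.2, u.2.2))
      ((v.1.1, q.1.1, q.1.2, v.1.2), (v.2.1, q.2.1, q.2.2, v.2.2)) * W u v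

end Adapter

/-! The fully signalling process is an identity channel from `X` to `Y`, so it suffices that `X`
simulates everything `W'` does and mails the result to `Y`.

Since `Y'` cannot signal to `X'`, the operator `W'` has the form `w ⊗ 𝟙_{Y_O'}` with `tr_{Y_I'} w =
ρ ⊗ 𝟙_{X_O'}` (`IsCausallyOrdered.exists_comb`). Such a `w` is a one-slot comb: with `ρ = S Sᴴ`,
prepare the purification of `ρ` given by `S`, hand one half to `X'`, keep the other as memory, and
afterwards apply a channel `Γ` to the memory and the returned system `X_O'`
(`exists_state_and_channel_of_comb`).

The adapter is then local. `X` discards `X_I`, prepares the purification, applies `Γ` and embeds its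
output `Y_I'` in the larger space `Q`. `Y` decodes `Q` back to `Y_I'`, discards `Y_O'` and feeds a
maximally mixed state into `Y_O`. `applyAdapter_kronecker_fullySignalling` evaluates the
composition. Freeness holds for every local adapter (`IsLocalAdapter.isNonSignallingAdapter`),
because the marginal conditions of a comb make the correction terms of `L_Z` cancel in pairs. -/

namespace Matrix

/-! ### Positivity, Hermitian spanning and pseudo-inverses -/

/-- A Hermitian matrix, scaled down, is a small perturbation of the identity. -/
theorem IsHermitian.exists_posSemidef_one_add_smul {n : Type*} [Fintype n] [DecidableEq n]
    {H : Matrix n n ℂ} (hH : H.IsHermitian) :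
    ∃ ε : ℝ, 0 < ε ∧ (1 + (ε : ℂ) • H).PosSemidef ∧ (1 - (ε : ℂ) • H).PosSemidef := by
  -- Any bound on the absolute eigenvalues would do; the summand 1 keeps `s` positive when `H = 0`.
  set s : ℝ := 1 + ∑ i, |hH.eigenvalues i|
  have hle : ∀ i, |hH.eigenvalues i| ≤ s := fun i => by
    have := Finset.single_le_sum (f := fun i => |hH.eigenvalues i|)
      (fun i _ => abs_nonneg _) (Finset.mem_univ i)
    linarith
  have hs0 : 0 < s := by positivity
  set U : Matrix n n ℂ := ↑hH.eigenvectorUnitary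
  have hU : U * Uᴴ = 1 := Unitary.coe_mul_star_self hH.eigenvectorUnitary
  have key : ∀ c : ℝ, |c| ≤ s⁻¹ → (1 + (c : ℂ) • H).PosSemidef := by
    intro c hc
    have hd : (1 + (c : ℂ) • H) =
        U * diagonal (fun i => ((1 + c * hH.eigenvalues i : ℝ) : ℂ)) * Uᴴ := by
      have h1 : diagonal (fun i => ((1 + c * hH.eigenvalues i : ℝ) : ℂ)) =
          1 + (c : ℂ) • diagonal (fun i => (hH.eigenvalues i : ℂ)) := by
        ext i j
        by_cases h : i = j <;> simp [h]
      have h2 : H = U * diagonal (fun i => (hH.eigenvalues i : ℂ)) * Uᴴ := hH.spectral_theorem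
      rw [h1, mul_add, add_mul, mul_one, hU, mul_smul_comm, smul_mul_assoc, ← h2]
    rw [hd]
    refine PosSemidef.mul_mul_conjTranspose_same (PosSemidef.diagonal fun i => ?_) U
    have : |c * hH.eigenvalues i| ≤ 1 := by
      rw [abs_mul]
      calc _ ≤ s⁻¹ * s := mul_le_mul hc (hle i) (abs_nonneg _) (by positivity)
        _ = 1 := inv_mul_cancel₀ hs0.ne'
    have := neg_le_of_abs_le this
    simp only [Pi.zero_apply, Complex.zero_le_real]
    linarith
  refine ⟨s⁻¹, by positivity, key _ (by rw [abs_of_pos (by positivity)]), ?_⟩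
  have := key (-s⁻¹) (by rw [abs_neg, abs_of_pos (by positivity)])
  simpa [sub_eq_add_neg] using this

/-- A linear functional on matrices that vanishes on the Hermitian elements of a star-closed
subspace vanishes on the subspace. -/
theorem map_eq_zero_of_isHermitian {n : Type*} (f : Matrix n n ℂ →ₗ[ℂ] ℂ)
    (p : Submodule ℂ (Matrix n n ℂ)) (hp : ∀ Z ∈ p, Zᴴ ∈ p)
    (hf : ∀ H ∈ p, H.IsHermitian → f H = 0) : ∀ Z ∈ p, f Z = 0 := by
  intro Z hZ
  have h1 := hf (Z + Zᴴ) (p.add_mem hZ (hp Z hZ)) (isHermitian_add_transpose_self Z)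
  have h2 := hf (Complex.I • (Z - Zᴴ)) (p.smul_mem _ (p.sub_mem hZ (hp Z hZ))) (by
    simp [IsHermitian, conjTranspose_smul, conjTranspose_sub, ← smul_neg])
  rw [map_smul, smul_eq_mul, mul_eq_zero, map_sub] at h2
  rw [map_add] at h1
  have h3 := h2.resolve_left Complex.I_ne_zero
  linear_combination (h1 + h3) / 2

-- Writing `A = Cᴴ C` turns the hypothesis into `(B Cᴴ)(B Cᴴ)ᴴ = 0`, hence `B Cᴴ = 0`.
open scoped MatrixOrder in
theorem PosSemidef.mul_eq_zero_of_mul_mul_conjTranspose {m n : Type*} [Fintype m] [Fintype n]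
    {A : Matrix n n ℂ} (hA : A.PosSemidef) {B : Matrix m n ℂ} (h : B * A * Bᴴ = 0) :
    B * A = 0 := by
  classical
  obtain ⟨C, rfl⟩ := CStarAlgebra.nonneg_iff_eq_star_mul_self.1 hA.nonneg
  rw [star_eq_conjTranspose] at h ⊢
  have : (B * Cᴴ) * (B * Cᴴ)ᴴ = 0 := by
    rw [conjTranspose_mul, conjTranspose_conjTranspose, ← h]
    simp only [Matrix.mul_assoc]
  rw [← Matrix.mul_assoc, self_mul_conjTranspose_eq_zero.1 this, Matrix.zero_mul]

/-- A square root of a positive semidefinite matrix, together with its pseudo-inverse and the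
projection onto the kernel. -/
theorem PosSemidef.exists_sqrt_pseudoinverse {n : Type*} [Fintype n] [DecidableEq n]
    {ρ : Matrix n n ℂ} (hρ : ρ.PosSemidef) :
    ∃ S T R : Matrix n n ℂ, S * Sᴴ = ρ ∧ R.PosSemidef ∧ T * ρ * Tᴴ + R = 1 ∧ S * R = 0 ∧
      (1 - S * T) * ρ = 0 := by
  set U : Matrix n n ℂ := ↑hρ.1.eigenvectorUnitary
  set l := hρ.1.eigenvalues
  have hl : ∀ i, 0 ≤ l i := hρ.eigenvalues_nonneg
  have hU : U * Uᴴ = 1 := Unitary.coe_mul_star_self hρ.1.eigenvectorUnitary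
  have hU' : Uᴴ * U = 1 := Unitary.coe_star_mul_self hρ.1.eigenvectorUnitary
  have hd : ρ = U * diagonal (fun i => (l i : ℂ)) * Uᴴ := hρ.1.spectral_theorem
  have hsq : ∀ i, ((√(l i) : ℝ) : ℂ) * ((√(l i) : ℝ) : ℂ) = (l i : ℂ) := fun i => by
    rw [← Complex.ofReal_mul, Real.mul_self_sqrt (hl i)]
  have hz : ∀ i, l i ≠ 0 → ((√(l i) : ℝ) : ℂ) ≠ 0 := fun i hi => by
    rw [Complex.ofReal_ne_zero]
    exact (Real.sqrt_pos.2 (lt_of_le_of_ne (hl i) (Ne.symm hi))).ne'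
  -- With `ρ = U Λ Uᴴ`, these are `U √Λ` and `√Λ⁻¹ Uᴴ`. Since `0⁻¹ = 0`, `T` is a pseudo-inverse.
  -- `R` projects onto the kernel in eigenbasis coordinates, which is why it is diagonal without
  -- `U`.
  set S : Matrix n n ℂ := U * diagonal (fun i => ((√(l i) : ℝ) : ℂ)) with hS
  set T : Matrix n n ℂ := diagonal (fun i => (((√(l i) : ℝ) : ℂ))⁻¹) * Uᴴ with hT
  set R : Matrix n n ℂ := diagonal (fun i => if l i = 0 then 1 else 0) with hR
  have hST : S * T * U = U * diagonal (fun i => if l i = 0 then 0 else 1) := by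
    rw [hS, hT]
    simp only [Matrix.mul_assoc, hU', Matrix.mul_one, diagonal_mul_diagonal]
    congr 2
    ext i
    by_cases h : l i = 0
    · simp [h]
    · simp [h, hz i h]
  refine ⟨S, T, R, ?_, PosSemidef.diagonal fun i => ?_, ?_, ?_, ?_⟩
  · rw [hS, conjTranspose_mul, diagonal_conjTranspose, hd]
    simp only [Matrix.mul_assoc]
    rw [← Matrix.mul_assoc (diagonal _) (diagonal _), diagonal_mul_diagonal]
    congr 3
    ext i
    simp [hsq]
  · dsimp only [Pi.zero_apply]
    split_ifs <;> simp
  · have : T * ρ * Tᴴ = diagonal (fun i => if l i = 0 then 0 else 1) := by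
      rw [hT, conjTranspose_mul, diagonal_conjTranspose, conjTranspose_conjTranspose, hd]
      calc _ = diagonal (fun i => (((√(l i) : ℝ) : ℂ))⁻¹) * (Uᴴ * U) *
            diagonal (fun i => (l i : ℂ)) * (Uᴴ * U) *
            diagonal (star fun i => (((√(l i) : ℝ) : ℂ))⁻¹) := by
              simp only [Matrix.mul_assoc]
        _ = _ := by
          rw [hU', Matrix.mul_one, Matrix.mul_one, diagonal_mul_diagonal, diagonal_mul_diagonal]
          congr 1
          ext i
          by_cases h : l i = 0
          · simp [h]
          · have := hz i h
            rw [← hsq i]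
            simp [h]
            field_simp
    rw [this, hR, diagonal_add, ← diagonal_one]
    congr 1
    ext i
    by_cases h : l i = 0 <;> simp [h]
  · rw [hS, hR, Matrix.mul_assoc, diagonal_mul_diagonal, ← Matrix.mul_zero U, ← diagonal_zero]
    congr 2
    ext i
    by_cases h : l i = 0 <;> simp [h]
  · rw [Matrix.sub_mul, Matrix.one_mul, sub_eq_zero]
    conv_rhs => rw [hd, ← Matrix.mul_assoc, ← Matrix.mul_assoc, hST, Matrix.mul_assoc U,
      diagonal_mul_diagonal]
    conv_lhs => rw [hd]
    congr 3
    ext i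
    by_cases h : l i = 0 <;> simp [h]

theorem trace_transpose_mul_eq_sum {n : Type*} [Fintype n] (K Z : Matrix n n ℂ) :
    (Kᵀ * Z).trace = ∑ u, ∑ v, K u v * Z u v := by
  simp only [trace, diag_apply, mul_apply, transpose_apply]
  exact Finset.sum_comm

end Matrix

open Matrix

/-! ### Channels, and the functionals that are constant on them -/

section Channels

variable {I O : Type*} [Fintype O]

theorem trace_partialTraceSnd [Fintype I] (M : Matrix (I × O) (I × O) ℂ) :
    (partialTraceSnd M).trace = M.trace := by
  simp [partialTraceSnd, trace, Fintype.sum_prod_type]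

theorem partialTraceSnd_kronecker_one_conj [Fintype I] [DecidableEq O] {J : Type*} [Fintype J] (B : Matrix J I ℂ)
    (M : Matrix (I × O) (I × O) ℂ) :
    partialTraceSnd ((B ⊗ₖ (1 : Matrix O O ℂ)) * M * (B ⊗ₖ (1 : Matrix O O ℂ))ᴴ) =
      B * partialTraceSnd M * Bᴴ := by
  ext i j
  simp only [partialTraceSnd, mul_apply, Fintype.sum_prod_type, kroneckerMap_apply,
    conjTranspose_apply, one_apply, mul_ite, mul_one, mul_zero, ite_mul, zero_mul, apply_ite star,
    star_zero, Finset.sum_ite_eq, Finset.mem_univ, if_true, Finset.sum_mul, Finset.mul_sum]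
  rw [Finset.sum_comm]
  refine Finset.sum_congr rfl fun x _ => ?_
  rw [Finset.sum_comm]

theorem partialTraceSnd_kronecker {J : Type*} (A : Matrix J J ℂ) (B : Matrix O O ℂ) :
    partialTraceSnd (A ⊗ₖ B) = B.trace • A := by
  ext i j
  simp [partialTraceSnd, trace, ← Finset.mul_sum, mul_comm]

theorem posSemidef_partialTraceSnd {M : Matrix (I × O) (I × O) ℂ} (hM : M.PosSemidef) :
    (partialTraceSnd M).PosSemidef := by
  have : partialTraceSnd M = ∑ o, M.submatrix (fun i => (i, o)) (fun i => (i, o)) := by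
    ext i j
    simp [partialTraceSnd, Matrix.sum_apply]
  rw [this]
  exact posSemidef_sum _ fun o _ => hM.submatrix _

variable [DecidableEq I] [DecidableEq O]

/-- The completely depolarising channel. -/
theorem isChannel_depolarizing [Nonempty O] :
    IsChannel (((Fintype.card O : ℂ)⁻¹) • (1 : Matrix (I × O) (I × O) ℂ)) := by
  refine ⟨PosSemidef.one.smul (by positivity), ?_⟩
  ext i j
  by_cases h : i = j <;> simp [partialTraceSnd, one_apply, h]

/-- The depolarising channel is interior to the set of channels, so a small step in any Hermitian
direction of zero partial trace stays inside. Functionals constant on channels therefore vanish on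
these directions. -/
theorem isChannel_depolarizing_add [Nonempty O] {Z : Matrix (I × O) (I × O) ℂ}
    (hZ : partialTraceSnd Z = 0) {ε : ℂ} (h : (1 + ε • Z).PosSemidef) :
    IsChannel (((Fintype.card O : ℂ)⁻¹) • (1 + ε • Z)) := by
  refine ⟨h.smul (by positivity), ?_⟩
  rw [← (isChannel_depolarizing (I := I) (O := O)).2]
  ext i j
  have : ∑ o, Z (i, o) (j, o) = 0 := congrFun (congrFun hZ i) j
  simp [partialTraceSnd, ← Finset.mul_sum, Finset.sum_add_distrib, this]

variable [Fintype I]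

/-- A functional that is constant on channels is of the form `K ⊗ 𝟙`. -/
theorem eq_kronecker_one_of_const_on_channels (K : Matrix (I × O) (I × O) ℂ)
    (hK : ∀ M M', IsChannel M → IsChannel M' → (Kᵀ * M).trace = (Kᵀ * M').trace) (o₀ : O) :
    K = (K.submatrix (fun i => (i, o₀)) (fun i => (i, o₀))) ⊗ₖ (1 : Matrix O O ℂ) := by
  have : Nonempty O := ⟨o₀⟩
  set f : Matrix (I × O) (I × O) ℂ →ₗ[ℂ] ℂ :=
    (traceLinearMap (I × O) ℂ ℂ).comp (LinearMap.mulLeft ℂ Kᵀ) with hf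
  have hfa : ∀ Z, f Z = (Kᵀ * Z).trace := fun Z => rfl
  let p : Submodule ℂ (Matrix (I × O) (I × O) ℂ) :=
    { carrier := {Z | partialTraceSnd Z = 0}
      add_mem' := by
        intro a b ha hb
        ext i j
        have h1 := congrFun (congrFun ha i) j
        have h2 := congrFun (congrFun hb i) j
        simp only [partialTraceSnd] at h1 h2
        simp [partialTraceSnd, Finset.sum_add_distrib, h1, h2]
      zero_mem' := by ext i j; simp [partialTraceSnd]
      smul_mem' := by
        intro c a ha
        ext i j
        have h1 := congrFun (congrFun ha i) j
        simp only [partialTraceSnd] at h1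
        simp [partialTraceSnd, ← Finset.mul_sum, h1] }
  have hp : ∀ Z, Z ∈ p ↔ partialTraceSnd Z = 0 := fun Z => Iff.rfl
  have key : ∀ Z ∈ p, f Z = 0 := by
    refine map_eq_zero_of_isHermitian f p (fun Z hZ => ?_) (fun H hH hH' => ?_)
    · rw [hp] at hZ ⊢
      ext i j
      have := congrArg star (congrFun (congrFun hZ j) i)
      simpa [partialTraceSnd] using this
    · obtain ⟨ε, hε, h1, -⟩ := hH'.exists_posSemidef_one_add_smul
      have h2 := hK _ _ (isChannel_depolarizing_add hH h1) isChannel_depolarizing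
      rw [← hfa, ← hfa, map_smul, map_smul, map_add, map_smul, smul_eq_mul, smul_eq_mul,
        smul_eq_mul] at h2
      have h3 : (Fintype.card O : ℂ)⁻¹ ≠ 0 := by simp
      have h4 := mul_left_cancel₀ h3 h2
      have h5 : (ε : ℂ) ≠ 0 := by exact_mod_cast hε.ne'
      exact (mul_eq_zero.1 (by linear_combination h4 : (ε : ℂ) * f H = 0)).resolve_left h5
  have hs : ∀ u v, f (Matrix.single u v 1) = K u v := fun u v => by
    rw [hfa, trace_transpose_mul_eq_sum, Finset.sum_eq_single u, Finset.sum_eq_single v] <;>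
      simp +contextual [Matrix.single_apply, eq_comm]
  -- Two kinds of matrix with zero partial trace suffice: differences of units diagonal in `O` make
  -- the diagonal blocks equal, and units off-diagonal in `O` kill the other blocks.
  ext ⟨i, o⟩ ⟨j, o'⟩
  by_cases h : o = o'
  · subst h
    have := key (Matrix.single (i, o) (j, o) 1 - Matrix.single (i, o₀) (j, o₀) 1) (by
      rw [hp]
      ext a b
      by_cases hh : i = a ∧ j = b
      · obtain ⟨rfl, rfl⟩ := hh
        simp [partialTraceSnd, Matrix.single_apply, Finset.sum_sub_distrib]
      · have : ∀ x y : O, ¬ ((i = a ∧ x = y) ∧ j = b ∧ x = y) := fun x y h => hh ⟨h.1.1, h.2.1⟩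
        simp [partialTraceSnd, this])
    rw [map_sub, hs, hs] at this
    simp [sub_eq_zero.1 this]
  · have := key (Matrix.single (i, o) (j, o') 1) (by
      rw [hp]
      ext a b
      have : ∀ x, ¬ ((i = a ∧ o = x) ∧ j = b ∧ o' = x) := fun x hx => h (hx.1.2.trans hx.2.2.symm)
      simp [partialTraceSnd, this])
    rw [hs] at this
    simp [this, h]

/-- Instrument elements separate matrices. -/
theorem eq_of_eq_on_instrumentElements [Nonempty O] (K K' : Matrix (I × O) (I × O) ℂ)
    (h : ∀ M, IsInstrumentElement M → (Kᵀ * M).trace = (K'ᵀ * M).trace) : K = K' := by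
  set f : Matrix (I × O) (I × O) ℂ →ₗ[ℂ] ℂ :=
    (traceLinearMap (I × O) ℂ ℂ).comp (LinearMap.mulLeft ℂ (K - K')ᵀ) with hf
  have hfa : ∀ Z, f Z = ((K - K')ᵀ * Z).trace := fun Z => rfl
  have h0 : ∀ M, IsInstrumentElement M → f M = 0 := fun M hM => by
    rw [hfa, transpose_sub, Matrix.sub_mul, trace_sub, h M hM, sub_self]
  have hc : (0 : ℂ) ≤ (Fintype.card O : ℂ)⁻¹ * 2⁻¹ := by positivity
  -- The elements for `Z` and `-Z` complete each other to the depolarising channel.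
  have hel : ∀ Z : Matrix (I × O) (I × O) ℂ, (1 + Z).PosSemidef → (1 - Z).PosSemidef →
      IsInstrumentElement (((Fintype.card O : ℂ)⁻¹ * 2⁻¹) • (1 + Z)) := fun Z h1 h2 => by
    refine ⟨h1.smul hc, _, h2.smul hc, ?_⟩
    rw [← smul_add, show 1 + Z + (1 - Z) = (2 : ℂ) • (1 : Matrix (I × O) (I × O) ℂ) by
      rw [two_smul]; abel, smul_smul, mul_assoc, inv_mul_cancel₀ two_ne_zero, mul_one]
    exact isChannel_depolarizing
  have key : ∀ Z ∈ (⊤ : Submodule ℂ (Matrix (I × O) (I × O) ℂ)), f Z = 0 := by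
    refine map_eq_zero_of_isHermitian f ⊤ (fun _ _ => trivial) (fun H _ hH => ?_)
    obtain ⟨ε, hε, h1, h2⟩ := hH.exists_posSemidef_one_add_smul
    have h3 := h0 _ (hel _ h1 h2)
    have h4 := h0 _ (hel 0 (by simpa using PosSemidef.one) (by simpa using PosSemidef.one))
    have h5 : (Fintype.card O : ℂ)⁻¹ * 2⁻¹ ≠ 0 := by simp
    rw [map_smul, smul_eq_mul, mul_eq_zero, or_iff_right h5, map_add] at h3 h4
    rw [map_zero, add_zero] at h4
    rw [h4, zero_add, map_smul, smul_eq_mul] at h3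
    exact (mul_eq_zero.1 h3).resolve_left (by exact_mod_cast hε.ne')
  have hs : ∀ u v, f (Matrix.single u v 1) = (K - K') u v := fun u v => by
    rw [hfa, trace_transpose_mul_eq_sum, Finset.sum_eq_single u, Finset.sum_eq_single v] <;>
      simp +contextual [Matrix.single_apply, eq_comm]
  ext u v
  have := (hs u v).symm.trans (key _ trivial)
  simpa [sub_eq_zero] using this

end Channels

/-! ### Structure of causally ordered processes -/

section CausalOrder

variable {XI XO YI YO : Type*} [Fintype XI] [Fintype XO] [Fintype YI] [Fintype YO]

/-- The operator on the spaces of `X` that is left when `Y` obtains the outcome `MY`. -/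
def conditionalOnSnd (W : Matrix ((XI × XO) × (YI × YO)) ((XI × XO) × (YI × YO)) ℂ)
    (MY : Matrix (YI × YO) (YI × YO) ℂ) : Matrix (XI × XO) (XI × XO) ℂ :=
  fun x x' => ∑ y, ∑ y', W (x, y) (x', y') * MY y y'

theorem outcomeProb_eq_trace (W : Matrix ((XI × XO) × (YI × YO)) ((XI × XO) × (YI × YO)) ℂ)
    (MX : Matrix (XI × XO) (XI × XO) ℂ) (MY : Matrix (YI × YO) (YI × YO) ℂ) :
    outcomeProb W MX MY = ((conditionalOnSnd W MY)ᵀ * MX).trace := by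
  rw [outcomeProb, trace_transpose_mul_eq_sum, trace_transpose_mul_eq_sum, Fintype.sum_prod_type]
  refine Finset.sum_congr rfl fun x _ => ?_
  rw [Finset.sum_comm, Fintype.sum_prod_type]
  refine Finset.sum_congr rfl fun x' _ => ?_
  rw [conditionalOnSnd, Finset.sum_mul, Finset.sum_comm]
  refine Finset.sum_congr rfl fun y _ => ?_
  rw [Finset.sum_mul]
  refine Finset.sum_congr rfl fun y' _ => ?_
  rw [kroneckerMap_apply]
  ring

variable [DecidableEq XI] [DecidableEq XO] [DecidableEq YI] [DecidableEq YO]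

/-- A process with causal order `X ≺ Y` is `w ⊗ 𝟙_{Y_O}`, where `w` is the Choi operator of a
one-slot comb: `tr_{Y_I} w = ρ ⊗ 𝟙_{X_O}` for a state `ρ`. -/
theorem IsCausallyOrdered.exists_comb [Nonempty XO] [Nonempty YO]
    {W : Matrix ((XI × XO) × (YI × YO)) ((XI × XO) × (YI × YO)) ℂ} (hW : IsCausallyOrdered W) :
    ∃ (w : Matrix ((XI × XO) × YI) ((XI × XO) × YI) ℂ) (ρ : Matrix XI XI ℂ),
      w.PosSemidef ∧ ρ.PosSemidef ∧ ρ.trace = 1 ∧ partialTraceSnd w = ρ ⊗ₖ (1 : Matrix XO XO ℂ) ∧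
      ∀ x y z x' y' z', W (x, (y, z)) (x', (y', z')) = if z = z' then w (x, y) (x', y') else 0 := by
  obtain ⟨z₀⟩ := ‹Nonempty YO›
  obtain ⟨o₀⟩ := ‹Nonempty XO›
  have : Nonempty XO := ⟨o₀⟩
  have : Nonempty YO := ⟨z₀⟩
  obtain ⟨⟨hpos, hone⟩, hcaus⟩ := hW
  have hcond : ∀ MY MY', IsChannel MY → IsChannel MY' →
      conditionalOnSnd W MY = conditionalOnSnd W MY' := fun MY MY' h h' =>
    eq_of_eq_on_instrumentElements _ _ fun M hM => by
      rw [← outcomeProb_eq_trace, ← outcomeProb_eq_trace, hcaus M MY MY' hM h h']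
  set w : Matrix ((XI × XO) × YI) ((XI × XO) × YI) ℂ :=
    W.submatrix (fun u => (u.1, (u.2, z₀))) (fun u => (u.1, (u.2, z₀))) with hw
  -- By `hcond`, each block of `W` with `x`, `x'` fixed is a functional of `MY` that is constant on
  -- channels, hence of the form `K ⊗ 𝟙`.
  have hfac : ∀ x y z x' y' z', W (x, (y, z)) (x', (y', z')) =
      if z = z' then w (x, y) (x', y') else 0 := fun x y z x' y' z' => by
    have := eq_kronecker_one_of_const_on_channels (W.submatrix (fun y => (x, y)) (fun y => (x', y)))
      (fun M M' h h' => by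
        rw [trace_transpose_mul_eq_sum, trace_transpose_mul_eq_sum]
        exact congrFun (congrFun (hcond M M' h h') x) x') z₀
    have := congrFun (congrFun this (y, z)) (y', z')
    simpa [one_apply, hw] using this
  have hwpos : w.PosSemidef := hpos.submatrix _
  set V := partialTraceSnd w with hV
  -- Because `W` is `w ⊗ 𝟙`, the trace over `YO` contributes its dimension, which cancels the
  -- normalisation of the depolarising channel. So `V` inherits value 1 on all channels of `X`.
  have hVc : V = conditionalOnSnd W (((Fintype.card YO : ℂ)⁻¹) • 1) := by
    ext x x'
    simp only [hV, partialTraceSnd, conditionalOnSnd, Fintype.sum_prod_type]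
    simp only [hfac, Matrix.smul_apply, one_apply, Prod.mk.injEq, smul_eq_mul, mul_ite,
      mul_one, mul_zero]
    refine Finset.sum_congr rfl fun y _ => ?_
    have : ∀ z : YO, (∑ y', ∑ z' : YO, if y = y' ∧ z = z' then
        (if z = z' then w (x, y) (x', y') else 0) * (Fintype.card YO : ℂ)⁻¹ else 0) =
        w (x, y) (x', y) * (Fintype.card YO : ℂ)⁻¹ := fun z => by
      rw [Finset.sum_eq_single y, Finset.sum_eq_single z]
      · simp
      · intro b _ hb
        simp [hb.symm]
      · simp
      · intro b _ hb
        simp [hb.symm]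
      · simp
    rw [Finset.sum_congr rfl fun z _ => this z]
    simp
    field_simp
  have hVone : ∀ M, IsChannel M → (Vᵀ * M).trace = 1 := fun M hM => by
    rw [hVc, ← outcomeProb_eq_trace]
    exact hone _ _ hM isChannel_depolarizing
  have hVρ := eq_kronecker_one_of_const_on_channels V
    (fun M M' h h' => (hVone M h).trans (hVone M' h').symm) o₀
  refine ⟨w, _, hwpos, (posSemidef_partialTraceSnd hwpos).submatrix _, ?_, hVρ, hfac⟩
  have h1 := hVone _ isChannel_depolarizing
  rw [mul_smul_comm, Matrix.mul_one, trace_smul, trace_transpose, hVρ, trace_kronecker, trace_one,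
    smul_eq_mul, mul_comm, mul_assoc, mul_inv_cancel₀ (by simp), mul_one] at h1
  exact h1

end CausalOrder

/-! ### Realising a one-slot comb by a state and a channel -/

section Dilation

variable {I O K : Type*} [Fintype I] [Fintype O] [Fintype K]
  [DecidableEq I] [DecidableEq O] [DecidableEq K]

/-- A one-slot comb is realised by a pure state shared with a memory, followed by a channel that
acts on the memory and on the input `O`. -/
theorem exists_state_and_channel_of_comb [Nonempty K] {w : Matrix ((I × O) × K) ((I × O) × K) ℂ}
    {ρ : Matrix I I ℂ} (hw : w.PosSemidef) (hρ : ρ.PosSemidef)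
    (htr : partialTraceSnd w = ρ ⊗ₖ (1 : Matrix O O ℂ)) :
    ∃ (S : Matrix I I ℂ) (Γ : Matrix ((O × I) × K) ((O × I) × K) ℂ), S * Sᴴ = ρ ∧ IsChannel Γ ∧
      ∀ i o k i' o' k', w ((i, o), k) ((i', o'), k') =
        ∑ m, ∑ n, S i m * star (S i' n) * Γ ((o, m), k) ((o', n), k') := by
  obtain ⟨S, T, R, hS, hR, hTR, hSR, hE⟩ := hρ.exists_sqrt_pseudoinverse
  let amp : Matrix I I ℂ → Matrix ((I × O) × K) ((I × O) × K) ℂ := fun A =>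
    (A ⊗ₖ (1 : Matrix O O ℂ)) ⊗ₖ (1 : Matrix K K ℂ)
  have amp_mul : ∀ A B, amp A * amp B = amp (A * B) := fun A B => by
    simp only [amp, ← mul_kronecker_mul, Matrix.mul_one]
  have amp_sub : ∀ A B, amp (A - B) = amp A - amp B := fun A B => by
    simp only [amp]
    ext ⟨⟨i, o⟩, k⟩ ⟨⟨i', o'⟩, k'⟩
    simp [sub_mul]
  have amp_one : amp 1 = 1 := by simp only [amp, one_kronecker_one]
  have amp_apply : ∀ (A : Matrix I I ℂ) (M : Matrix ((I × O) × K) ((I × O) × K) ℂ) i o k v,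
      (amp A * M) ((i, o), k) v = ∑ m, A i m * M ((m, o), k) v := by
    intro A M i o k v
    simp [amp, mul_apply, Fintype.sum_prod_type, one_apply]
  have apply_amp : ∀ (A : Matrix I I ℂ) (M : Matrix ((I × O) × K) ((I × O) × K) ℂ) i o k v,
      (M * (amp A)ᴴ) v ((i, o), k) =
      ∑ m, M v ((m, o), k) * star (A i m) := by
    intro A M i o k v
    simp [amp, mul_apply, Fintype.sum_prod_type, one_apply, apply_ite (starRingEnd ℂ)]
  have hptr : ∀ A, partialTraceSnd (amp A * w * (amp A)ᴴ) =
      (A * ρ * Aᴴ) ⊗ₖ (1 : Matrix O O ℂ) := fun A => by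
    simp only [amp]
    rw [partialTraceSnd_kronecker_one_conj, htr, conjTranspose_kronecker, conjTranspose_one,
      ← mul_kronecker_mul, ← mul_kronecker_mul, Matrix.one_mul, Matrix.mul_one]
  -- The support of `w` lies over that of `ρ`: `1 - S T` annihilates `ρ`, so compressing `w` by it
  -- gives a positive matrix of trace zero.
  have hEw : amp (S * T) * w = w := by
    have h0 : amp (1 - S * T) * w * (amp (1 - S * T))ᴴ = 0 := by
      rw [← (hw.mul_mul_conjTranspose_same _).trace_eq_zero_iff, ← trace_partialTraceSnd, hptr, hE]
      simp
    have := hw.mul_eq_zero_of_mul_mul_conjTranspose h0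
    rw [amp_sub, Matrix.sub_mul, amp_one, Matrix.one_mul, sub_eq_zero] at this
    exact this.symm
  -- Compressing `w` by `T` is trace preserving only off the kernel block. `D` adds a maximally
  -- mixed output on that block, and `S R = 0` makes it invisible once `S` is applied.
  set D : Matrix ((I × O) × K) ((I × O) × K) ℂ :=
    (R ⊗ₖ (1 : Matrix O O ℂ)) ⊗ₖ ((Fintype.card K : ℂ)⁻¹ • (1 : Matrix K K ℂ)) with hD
  set G := amp T * w * (amp T)ᴴ + D with hG
  have hSD : amp S * D = 0 := by
    simp only [amp, hD, ← mul_kronecker_mul, hSR]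
    simp
  have hSG : amp S * G * (amp S)ᴴ = w := by
    have h2 : w * (amp (S * T))ᴴ = w := by
      have := congrArg conjTranspose hEw
      rwa [conjTranspose_mul, hw.1.eq] at this
    rw [hG, Matrix.mul_add, hSD, add_zero, ← Matrix.mul_assoc, ← Matrix.mul_assoc, amp_mul, hEw,
      Matrix.mul_assoc, ← conjTranspose_mul, amp_mul, h2]
  have hGtr : partialTraceSnd G = 1 := by
    have : partialTraceSnd G = partialTraceSnd (amp T * w * (amp T)ᴴ) + partialTraceSnd D := by
      ext i j
      simp [partialTraceSnd, hG, Finset.sum_add_distrib]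
    rw [this, hptr, hD, partialTraceSnd_kronecker, trace_smul, trace_one, smul_eq_mul,
      inv_mul_cancel₀ (by simp), one_smul, ← add_kronecker, hTR, one_kronecker_one]
  have hGpos : G.PosSemidef :=
    (hw.mul_mul_conjTranspose_same _).add
      ((hR.kronecker PosSemidef.one).kronecker (PosSemidef.one.smul (by positivity)))
  refine ⟨S, G.submatrix (fun u => ((u.1.2, u.1.1), u.2)) (fun u => ((u.1.2, u.1.1), u.2)), hS,
    ⟨hGpos.submatrix _, ?_⟩, ?_⟩
  · ext ⟨o, m⟩ ⟨o', n⟩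
    have := congrFun (congrFun hGtr (m, o)) (n, o')
    simpa [partialTraceSnd, one_apply, and_comm] using this
  · intro i o k i' o' k'
    rw [← hSG, apply_amp, Finset.sum_comm]
    refine Finset.sum_congr rfl fun n _ => ?_
    rw [amp_apply, Finset.sum_mul]
    refine Finset.sum_congr rfl fun m _ => ?_
    simp only [submatrix_apply]
    ring

end Dilation

/-! ### Local combs and freeness of local adapters -/

theorem Matrix.PosSemidef.sum_snd {X M : Type*} [Fintype X] [Fintype M]
    {A : Matrix (X × M) (X × M) ℂ} (hA : A.PosSemidef) :
    Matrix.PosSemidef (fun u v => ∑ m, ∑ n, A (u, m) (v, n) : Matrix X X ℂ) := by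
  classical
  let B : Matrix X (X × M) ℂ := fun u x => if x.1 = u then 1 else 0
  have hB : ∀ u x, B u x = if x.1 = u then 1 else 0 := fun _ _ => rfl
  suffices h : (fun u v => ∑ m, ∑ n, A (u, m) (v, n) : Matrix X X ℂ) = B * A * Bᴴ by
    rw [h]
    exact hA.mul_mul_conjTranspose_same B
  ext u v
  simp only [hB, mul_apply, conjTranspose_apply, Fintype.sum_prod_type_right, ite_mul, one_mul,
    zero_mul, apply_ite star, star_one, star_zero, mul_ite, mul_one, mul_zero, Finset.sum_ite_eq',
    Finset.mem_univ, if_true]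
  exact Finset.sum_comm

/-- The memory of a local comb may be indexed by any finite type. -/
theorem isLocalComb_linkMemory {I I' O' O M : Type*} [Fintype I'] [Fintype O]
    [DecidableEq I] [DecidableEq O'] [Fintype M] [DecidableEq M]
    {L : Matrix (I × (I' × M)) (I × (I' × M)) ℂ} {G : Matrix ((O' × M) × O) ((O' × M) × O) ℂ}
    (hL : IsChannel L) (hG : IsChannel G) : IsLocalComb (linkMemory L G) := by
  let e := (Fintype.equivFin M).symm
  refine ⟨Fintype.card M, L.submatrix (fun u => (u.1, (u.2.1, e u.2.2)))
    (fun u => (u.1, (u.2.1, e u.2.2))), G.submatrix (fun u => ((u.1.1, e u.1.2), u.2))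
    (fun u => ((u.1.1, e u.1.2), u.2)), ⟨hL.1.submatrix _, ?_⟩, ⟨hG.1.submatrix _, ?_⟩, ?_⟩
  · rw [← hL.2]
    ext i j
    simp only [partialTraceSnd, submatrix_apply, Fintype.sum_prod_type]
    refine Finset.sum_congr rfl fun i' _ => ?_
    exact e.sum_comp fun m => L (i, (i', m)) (j, (i', m))
  · ext ⟨o, m⟩ ⟨p, n⟩
    have := congrFun (congrFun hG.2 (o, e m)) (p, e n)
    simpa [partialTraceSnd, one_apply] using this
  · ext u v
    simp only [linkMemory, submatrix_apply]
    rw [← e.sum_comp]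
    refine Finset.sum_congr rfl fun m _ => ?_
    rw [← e.sum_comp]

section Comb

variable {I I' O' O : Type*} [Fintype I] [Fintype I'] [Fintype O'] [Fintype O]
  [DecidableEq I] [DecidableEq O']

/-- `C` is a positive operator that satisfies the marginal conditions of a comb which receives `I`,
hands out `I'`, receives `O'` and returns `O`. -/
def IsComb (C : Matrix (I × I' × O' × O) (I × I' × O' × O) ℂ) : Prop :=
  C.PosSemidef ∧ ∃ l : Matrix (I × I') (I × I') ℂ, partialTraceSnd l = 1 ∧
    ∀ i i' o' j j' p', ∑ o, C (i, i', o', o) (j, j', p', o) =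
      if o' = p' then l (i, i') (j, j') else 0

/-- Trace preservation of `G` gives the identity on `O'` and closes the memory indices, leaving `L`
with its memory traced out; trace preservation of `L` then handles `I'`. -/
theorem isComb_linkMemory {M : Type*} [Fintype M] [DecidableEq M]
    {L : Matrix (I × (I' × M)) (I × (I' × M)) ℂ} {G : Matrix ((O' × M) × O) ((O' × M) × O) ℂ}
    (hL : IsChannel L) (hG : IsChannel G) : IsComb (linkMemory L G) := by
  refine ⟨?_, fun u v => ∑ m, L (u.1, (u.2, m)) (v.1, (v.2, m)), ?_, ?_⟩
  · let e : ((I × I' × O' × O) × M) → (I × (I' × M)) × ((O' × M) × O) := fun u =>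
      ((u.1.1, (u.1.2.1, u.2)), ((u.1.2.2.1, u.2), u.1.2.2.2))
    exact ((hL.1.kronecker hG.1).submatrix e).sum_snd
  · rw [← hL.2]
    ext i j
    simp [partialTraceSnd, Fintype.sum_prod_type]
  · intro i i' o' j j' p'
    have h : ∀ m n, ∑ o, G ((o', m), o) ((p', n), o) = if o' = p' ∧ m = n then 1 else 0 :=
      fun m n => by
        have := congrFun (congrFun hG.2 (o', m)) (p', n)
        simpa [partialTraceSnd, one_apply] using this
    simp only [linkMemory]
    rw [Finset.sum_comm]
    simp only [Finset.sum_comm (s := (Finset.univ : Finset O)), ← Finset.mul_sum, h]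
    by_cases ho : o' = p' <;> simp [ho]

theorem IsLocalComb.isComb {C : Matrix (I × I' × O' × O) (I × I' × O' × O) ℂ}
    (hC : IsLocalComb C) : IsComb C := by
  obtain ⟨d, L, G, hL, hG, rfl⟩ := hC
  exact isComb_linkMemory hL hG

theorem IsComb.trace_eq {C : Matrix (I × I' × O' × O) (I × I' × O' × O) ℂ} (hC : IsComb C) :
    C.trace = Fintype.card I * Fintype.card O' := by
  obtain ⟨-, l, hl, hCl⟩ := hC
  have hl' : ∀ i, ∑ i', l (i, i') (i, i') = 1 := fun i => by
    have := congrFun (congrFun hl i) i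
    simpa [partialTraceSnd] using this
  simp only [trace, diag_apply, Fintype.sum_prod_type, hCl, if_true, Finset.sum_const,
    Finset.card_univ, ← Finset.mul_sum, hl', nsmul_eq_mul]
  ring

variable [DecidableEq I'] [DecidableEq O]

/-- Tracing `O` leaves the identity on `O'`, so `_O` and `_{O O'}` agree; tracing also `I'` and `O'`
leaves a multiple of the identity on `I`, so `_{I' O O'}` and `_{I I' O O'}` agree. The four
corrections cancel. -/
theorem IsComb.projFst_kronecker {R : Type*} {C : Matrix (I × I' × O' × O) (I × I' × O' × O) ℂ}
    (hC : IsComb C) (B : Matrix R R ℂ) : projFst (C ⊗ₖ B) = C ⊗ₖ B := by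
  obtain ⟨-, l, hl, hCl⟩ := hC
  have hl' : ∀ i j, ∑ i', l (i, i') (j, i') = if i = j then 1 else 0 := fun i j =>
    congrFun (congrFun hl i) j
  have h1 : traceReplace (splitO I I' O' O R) (C ⊗ₖ B) =
      traceReplace (splitOO I I' O' O R) (C ⊗ₖ B) := by
    ext ⟨⟨i, i', o', o⟩, r⟩ ⟨⟨j, j', p', p⟩, s⟩
    have h0 : (Fintype.card O' : ℂ) ≠ 0 := by
      have : Nonempty O' := ⟨o'⟩
      simp
    simp only [traceReplace, splitO, splitOO, Equiv.coe_fn_mk, Equiv.coe_fn_symm_mk,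
      kroneckerMap_apply, ← Finset.sum_mul, Fintype.sum_prod_type, hCl, Prod.mk.injEq]
    by_cases ho : o = p <;> by_cases ho' : o' = p' <;> simp [ho, ho', Fintype.card_prod]
    field_simp
  have h2 : traceReplace (splitIOO I I' O' O R) (C ⊗ₖ B) =
      traceReplace (Equiv.refl _) (C ⊗ₖ B) := by
    ext ⟨⟨i, i', o', o⟩, r⟩ ⟨⟨j, j', p', p⟩, s⟩
    have h0 : (Fintype.card I : ℂ) ≠ 0 := by
      have : Nonempty I := ⟨i⟩
      simp
    have h0' : (Fintype.card O' : ℂ) ≠ 0 := by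
      have : Nonempty O' := ⟨o'⟩
      simp
    simp only [traceReplace, splitIOO, Equiv.coe_fn_mk, Equiv.coe_fn_symm_mk, Equiv.refl_apply,
      Equiv.refl_symm,
      kroneckerMap_apply, ← Finset.sum_mul, Fintype.sum_prod_type, hCl, Prod.mk.injEq, if_true,
      Finset.sum_const, ← Finset.mul_sum, hl', Fintype.card_prod, Finset.card_univ, nsmul_eq_mul]
    by_cases hi : i = j <;> by_cases hi' : i' = j' <;> by_cases ho : o = p <;>
      by_cases ho' : o' = p' <;> simp [hi, hi', ho, ho']
    field_simp
  rw [projFst, h1, h2]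
  abel

end Comb

section Adapters

variable {XI XI' XO' XO YI YI' YO' YO : Type*}
  [Fintype XI] [Fintype XI'] [Fintype XO'] [Fintype XO]
  [Fintype YI] [Fintype YI'] [Fintype YO'] [Fintype YO]
  [DecidableEq XI] [DecidableEq XI'] [DecidableEq XO'] [DecidableEq XO]
  [DecidableEq YI] [DecidableEq YI'] [DecidableEq YO'] [DecidableEq YO]

theorem IsLocalAdapter.isNonSignallingAdapter
    {U : Matrix ((XI × XI' × XO' × XO) × (YI × YI' × YO' × YO))
      ((XI × XI' × XO' × XO) × (YI × YI' × YO' × YO)) ℂ} (hU : IsLocalAdapter U) :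
    IsNonSignallingAdapter U := by
  obtain ⟨CX, CY, hX, hY, rfl⟩ := hU
  have hX := hX.isComb
  have hY := hY.isComb
  refine ⟨hX.1.kronecker hY.1, ?_, ?_⟩
  · have hswap : (CX ⊗ₖ CY).submatrix Prod.swap Prod.swap = CY ⊗ₖ CX := by
      ext u v
      simp [mul_comm]
    have hswap' : (CY ⊗ₖ CX).submatrix Prod.swap Prod.swap = CX ⊗ₖ CY := by
      ext u v
      simp [mul_comm]
    rw [projSnd, hswap, hY.projFst_kronecker, hswap', hX.projFst_kronecker]
  · rw [trace_kronecker, hX.trace_eq, hY.trace_eq]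
    ring

end Adapters

/-! ### Encoding into a larger space and decoding -/

section Embedding

variable {A K Q : Type*} [Fintype A] [Fintype K] [Fintype Q] [DecidableEq A] [DecidableEq K]
  [DecidableEq Q]

/-- Extending the output space of a channel along an embedding of bases. -/
theorem IsChannel.exists_embed_output {Γ : Matrix (A × K) (A × K) ℂ} (hΓ : IsChannel Γ)
    (ι : K ↪ Q) : ∃ G : Matrix (A × Q) (A × Q) ℂ, IsChannel G ∧
      ∀ (x y : A) (F : Q → Q → ℂ), ∑ a, ∑ b, G (x, a) (y, b) * F a b =
        ∑ k, ∑ l, Γ (x, k) (y, l) * F (ι k) (ι l) := by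
  let J : Matrix (A × Q) (A × K) ℂ := fun u v => if u = (v.1, ι v.2) then 1 else 0
  have hJ : ∀ u v, J u v = if u = (v.1, ι v.2) then 1 else 0 := fun _ _ => rfl
  have hG : ∀ x y (F : Q → Q → ℂ), ∑ a, ∑ b, (J * Γ * Jᴴ) (x, a) (y, b) * F a b =
      ∑ k, ∑ l, Γ (x, k) (y, l) * F (ι k) (ι l) := fun x y F => by
    have h : ∀ a b, (J * Γ * Jᴴ) (x, a) (y, b) =
        ∑ k, ∑ l, if a = ι k then (if b = ι l then Γ (x, k) (y, l) else 0) else 0 := fun a b => by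
      simp only [hJ, mul_apply, conjTranspose_apply, Fintype.sum_prod_type, Prod.mk.injEq, ite_and,
        apply_ite star, star_one, star_zero, mul_ite, mul_one, mul_zero, ite_mul, one_mul, zero_mul]
      simp [Finset.sum_ite_irrel]
      simp only [← Finset.sum_filter]
      exact Finset.sum_comm
    simp only [h, Finset.sum_mul, ite_mul, zero_mul]
    simp only [Finset.sum_comm (s := (Finset.univ : Finset Q)) (t := (Finset.univ : Finset K))]
    simp
  refine ⟨J * Γ * Jᴴ, ⟨hΓ.1.mul_mul_conjTranspose_same J, ?_⟩, hG⟩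
  rw [← hΓ.2]
  ext x y
  have := hG x y fun a b => if a = b then 1 else 0
  simpa [partialTraceSnd] using this

/-- A channel that inverts an embedding of bases. -/
theorem exists_channel_leftInverse [Nonempty K] (ι : K ↪ Q) :
    ∃ D : Matrix (Q × K) (Q × K) ℂ, IsChannel D ∧
      ∀ i j k l, D (ι i, k) (ι j, l) = if i = k ∧ j = l then 1 else 0 := by
  classical
  -- The projector on `v` decodes the range of `ι`; `P` sends the complement to the maximally mixed
  -- state, restoring trace preservation.
  let v : Q × K → ℂ := fun u => if u.1 = ι u.2 then 1 else 0
  let P : Matrix Q Q ℂ := diagonal fun q => if ∃ k, q = ι k then 0 else 1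
  refine ⟨vecMulVec v (star v) + P ⊗ₖ ((Fintype.card K : ℂ)⁻¹ • 1), ⟨?_, ?_⟩, ?_⟩
  · refine (posSemidef_vecMulVec_self_star v).add (PosSemidef.kronecker ?_
      (PosSemidef.one.smul (by positivity)))
    refine PosSemidef.diagonal fun q => ?_
    dsimp only [Pi.zero_apply]
    split_ifs <;> simp
  · ext q q'
    have h1 : ∀ o, P q q' * ((Fintype.card K : ℂ)⁻¹ • (1 : Matrix K K ℂ)) o o =
        (Fintype.card K : ℂ)⁻¹ * P q q' := fun o => by simp [mul_comm]
    simp only [partialTraceSnd, Matrix.add_apply, kroneckerMap_apply, Finset.sum_add_distrib, h1]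
    simp only [Finset.sum_const, Finset.card_univ, nsmul_eq_mul]
    rw [mul_inv_cancel_left₀ (by simp)]
    by_cases hq : ∃ k, q = ι k
    · obtain ⟨k, rfl⟩ := hq
      simp [v, P, vecMulVec_apply, diagonal_apply, one_apply, eq_comm]
      rw [Finset.sum_eq_single k] <;> simp +contextual [eq_comm]
    · have : ∀ k, q ≠ ι k := fun k hk => hq ⟨k, hk⟩
      simp [v, P, vecMulVec_apply, diagonal_apply, one_apply, this]
  · intro i j k l
    by_cases hi : i = k <;> by_cases hj : j = l <;>
      simp [v, P, vecMulVec_apply, diagonal_apply, hi, hj]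

end Embedding

/-! ### Assembling the adapter -/

/-- The action of a product of combs on the fully signalling process. -/
theorem applyAdapter_kronecker_fullySignalling {XI Q YO XI' XO' YI' YO' : Type*}
    [Fintype XI] [Fintype Q] [Fintype YO] [DecidableEq XI] [DecidableEq Q] [DecidableEq YO]
    (CX : Matrix (XI × XI' × XO' × Q) (XI × XI' × XO' × Q) ℂ)
    (CY : Matrix (Q × YI' × YO' × YO) (Q × YI' × YO' × YO) ℂ)
    (p q : (XI' × XO') × (YI' × YO')) :
    applyAdapter (CX ⊗ₖ CY) (fullySignalling XI Q YO) p q =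
      (Fintype.card XI : ℂ)⁻¹ * ∑ a, ∑ b,
        (∑ x, CX (x, p.1.1, p.1.2, a) (x, q.1.1, q.1.2, b)) *
          ∑ y, CY (a, p.2.1, p.2.2, y) (b, q.2.1, q.2.2, y) := by
  have hW : ∀ x a a' y x' b b' y', fullySignalling XI Q YO ((x, a), (a', y)) ((x', b), (b', y')) =
      if x = x' then (if y = y' then (if a = a' then (if b = b' then (Fintype.card XI : ℂ)⁻¹ else 0)
        else 0) else 0) else 0 := by
    intro x a a' y x' b b' y'
    simp only [fullySignalling, phiPlus, submatrix_apply, kroneckerMap_apply, Matrix.smul_apply,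
      one_apply, smul_eq_mul]
    split_ifs <;> simp_all
  simp only [applyAdapter, Fintype.sum_prod_type, hW, kroneckerMap_apply, mul_ite, mul_zero,
    Finset.sum_ite_irrel, Finset.sum_const_zero, Finset.sum_ite_eq, Finset.mem_univ, if_true]
  simp only [Finset.mul_sum, Finset.sum_mul]
  rw [Finset.sum_comm]
  refine Finset.sum_congr rfl fun a _ => ?_
  rw [Finset.sum_congr rfl fun x _ => Finset.sum_comm, Finset.sum_comm]
  refine Finset.sum_congr rfl fun b _ => ?_
  rw [Finset.sum_comm]
  refine Finset.sum_congr rfl fun y _ => Finset.sum_congr rfl fun x _ => ?_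
  rw [mul_comm]

theorem mainTheorem5
    {XI Q YO XI' XO' YI' YO' : Type*}
    [Fintype XI] [Fintype Q] [Fintype YO]
    [Fintype XI'] [Fintype XO'] [Fintype YI'] [Fintype YO']
    [DecidableEq XI] [DecidableEq Q] [DecidableEq YO]
    [DecidableEq XI'] [DecidableEq XO'] [DecidableEq YI'] [DecidableEq YO']
    [Nonempty XI'] [Nonempty XO'] [Nonempty YI'] [Nonempty YO']
    (hXI : Fintype.card XI' ≤ Fintype.card XI)
    (hXO : Fintype.card XO' ≤ Fintype.card Q)
    (hYI : Fintype.card YI' ≤ Fintype.card Q)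
    (hYO : Fintype.card YO' ≤ Fintype.card YO)
    (W' : Matrix ((XI' × XO') × (YI' × YO')) ((XI' × XO') × (YI' × YO')) ℂ)
    (hW' : IsCausallyOrdered W') :
    ∃ U : Matrix ((XI × XI' × XO' × Q) × (Q × YI' × YO' × YO))
        ((XI × XI' × XO' × Q) × (Q × YI' × YO' × YO)) ℂ,
      IsNonSignallingAdapter U ∧ IsLocalAdapter U ∧
        applyAdapter U (fullySignalling XI Q YO) = W' := by
  have : Nonempty XI := Fintype.card_pos_iff.1 (Fintype.card_pos.trans_le hXI)
  have : Nonempty YO := Fintype.card_pos_iff.1 (Fintype.card_pos.trans_le hYO)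
  obtain ⟨ι⟩ := Function.Embedding.nonempty_of_card_le hYI
  obtain ⟨w, ρ, hw, hρ, hρtr, htr, hWw⟩ := hW'.exists_comb
  obtain ⟨S, Γ, hS, hΓ, hwΓ⟩ := exists_state_and_channel_of_comb hw hρ htr
  obtain ⟨G, hG, hGΓ⟩ := hΓ.exists_embed_output ι
  obtain ⟨D, hD, hDι⟩ := exists_channel_leftInverse ι
  -- The entries of `S` are the amplitudes of the purification, so its memory is a copy of `XI'`;
  -- the factor 1 in `L` discards `XI`.
  let s : XI' × XI' → ℂ := fun u => S u.1 u.2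
  let L : Matrix (XI × (XI' × XI')) (XI × (XI' × XI')) ℂ := 1 ⊗ₖ vecMulVec s (star s)
  have hL : IsChannel L := by
    refine ⟨PosSemidef.one.kronecker (posSemidef_vecMulVec_self_star s), ?_⟩
    have : (vecMulVec s (star s)).trace = 1 := by
      rw [← hρtr, ← hS]
      simp [trace, vecMulVec_apply, mul_apply, Fintype.sum_prod_type, s]
    rw [partialTraceSnd_kronecker, this, one_smul]
  let L' : Matrix (Q × (YI' × Unit)) (Q × (YI' × Unit)) ℂ :=
    D.submatrix (fun u => (u.1, u.2.1)) (fun u => (u.1, u.2.1))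
  have hL' : IsChannel L' := by
    refine ⟨hD.1.submatrix _, ?_⟩
    rw [← hD.2]
    ext a b
    simp [partialTraceSnd, L', Fintype.sum_prod_type]
  have hlocal : IsLocalAdapter (linkMemory L G ⊗ₖ
      linkMemory L' (((Fintype.card YO : ℂ)⁻¹) • (1 : Matrix ((YO' × Unit) × YO) _ ℂ))) :=
    ⟨_, _, isLocalComb_linkMemory hL hG, isLocalComb_linkMemory hL' isChannel_depolarizing, rfl⟩
  refine ⟨_, hlocal.isNonSignallingAdapter, hlocal, ?_⟩
  ext ⟨⟨i, o⟩, ⟨k, z⟩⟩ ⟨⟨i', o'⟩, ⟨k', z'⟩⟩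
  -- The factor `Fintype.card XI` from tracing the discarded input cancels the normalisation of the
  -- fully signalling process.
  have hX : ∀ a b, ∑ x, linkMemory L G (x, i, o, a) (x, i', o', b) =
      Fintype.card XI * ∑ m, ∑ n, S i m * star (S i' n) * G ((o, m), a) ((o', n), b) :=
    fun a b => by simp [linkMemory, L, s, vecMulVec_apply]
  have hY : ∀ a b, ∑ y, linkMemory L' (((Fintype.card YO : ℂ)⁻¹) •
      (1 : Matrix ((YO' × Unit) × YO) _ ℂ)) (a, k, z, y) (b, k', z', y) =
        if z = z' then D (a, k) (b, k') else 0 := fun a b => by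
    by_cases hz : z = z' <;> simp [linkMemory, L', one_apply, hz]
    field_simp
  rw [applyAdapter_kronecker_fullySignalling, hWw, hwΓ]
  simp only [hX, hY]
  by_cases hz : z = z'
  · simp only [hz, if_true, mul_assoc, ← Finset.mul_sum]
    rw [inv_mul_cancel_left₀ (by simp)]
    simp only [Finset.sum_mul, mul_assoc]
    simp only [Finset.sum_comm (s := (Finset.univ : Finset Q)) (t := (Finset.univ : Finset XI')),
      ← Finset.mul_sum, hGΓ, hDι, ite_and]
    simp
  · simp [hz]
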